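/- Let $1\le m\le n$ be integers and $p\in[0,1]$. Cars $1,\dots,m$ enter, one after the other, a one-way street with spots $1,\dots,n$, initially empty. Car $i$ has a preferred spot $a_i\in[n]=\{1,\dots,n\}$ and parks there if it is free. If it is occupied, an independent coin with heads probability $p$ is tossed once: on heads the car drives forward and parks in the first free spot after $a_i$, and on tails it drives backward and parks in the nearest free spot before $a_i$; if there is no such spot, the car fails to park. The preference list $\alpha=(a_1,\dots,a_m)$ is chosen uniformly at random from $[n]^m$, independently of the coins. Let $\mathbb{E}(a_m\mid \alpha \text{ parks})$ be the conditional expectation of the preference of the last car given that all $m$ cars park (an event of positive probability). Fix $0<c<1$. Then, as $n\to\infty$ through the integers for which $m=cn$ is an integer, $$\mathbb{E}(a_m\mid \alpha \text{ parks})=\frac{n+1}{2}-(2p-1)\,\frac{c}{2(1-c)}-\frac1n\,(2p-1)\,\frac{c^2-c-1}{2(1-c)^3}+O\left(n^{-2}\right),$$ where the constant implied by $O(n^{-2})$ depends only on $c$ (in particular, not on $p\in[0,1]$). -/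

import Mathlib

namespace ProbParking

/-- The spot taken by a car with preferred spot `a` when the spots in `occ` are occupied. Spots
are the elements of `Fin n`, in street order; spot number `i + 1` is the element with value `i`.
The car parks at `a` if `a` is free. Otherwise a coin is used: on heads (`true`) the car drives
forward to the first free spot after `a`, on tails (`false`) it drives backward to the first free
spot it meets before `a`. The value is `none` if there is no such spot. -/
def nextSpot {n : ℕ} (occ : Finset (Fin n)) (a : Fin n) (coin : Bool) : Option (Fin n) :=
  if a ∉ occ then some a
  else if coin = true then
    if h : (Finset.univ.filter fun j : Fin n => j ∉ occ ∧ a < j).Nonempty then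
      some (Finset.min' _ h)
    else none
  else
    if h : (Finset.univ.filter fun j : Fin n => j ∉ occ ∧ j < a).Nonempty then
      some (Finset.max' _ h)
    else none

/-- The set of occupied spots after `m` cars with preferences `α 0, …, α (m - 1)` have arrived one
after the other, starting from an empty street with `n` spots, where car `i` uses the coin `coin i`
if it finds its preferred spot occupied. The value is `none` if some car fails to park. -/
def occupied {n : ℕ} : (m : ℕ) → (Fin m → Fin n) → (Fin m → Bool) → Option (Finset (Fin n))
  | 0, _, _ => some ∅
  | k + 1, α, coin =>
      (occupied k (fun i => α i.castSucc) (fun i => coin i.castSucc)).bind fun occ =>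
        (nextSpot occ (α (Fin.last k)) (coin (Fin.last k))).map fun s => insert s occ

/-- All `m` cars park. -/
def AllPark {m n : ℕ} (α : Fin m → Fin n) (coin : Fin m → Bool) : Prop :=
  (occupied m α coin).isSome = true

instance {m n : ℕ} (α : Fin m → Fin n) (coin : Fin m → Bool) : Decidable (AllPark α coin) :=
  inferInstanceAs (Decidable (_ = true))

/-- The preference of the last car, as a number in `{1, …, n}` (`0` if there are no cars). -/
def lastPref {n : ℕ} : {m : ℕ} → (Fin m → Fin n) → ℕ
  | 0, _ => 0
  | k + 1, α => (α (Fin.last k) : ℕ) + 1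

/-- The probability of the outcome `(α, coin)`: the preference list `α` is uniform on the `n ^ m`
lists, and the coins are independent of `α` and of each other, with heads probability `p`. -/
noncomputable def outcomeProb {m n : ℕ} (p : ℝ) (α : Fin m → Fin n) (coin : Fin m → Bool) : ℝ :=
  ((n : ℝ) ^ m)⁻¹ * ∏ i, (if coin i = true then p else 1 - p)

/-- The probability that all `m` cars park on `n` spots. -/
noncomputable def probAllPark (m n : ℕ) (p : ℝ) : ℝ :=
  ∑ α : Fin m → Fin n, ∑ coin : Fin m → Bool,
    if AllPark α coin then outcomeProb p α coin else 0

/-- The conditional expectation of the preference of the last car given that all `m` cars park on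
`n` spots: the expectation of the preference on the event that all cars park, divided by the
probability of that event. -/
noncomputable def condExpLastPref (m n : ℕ) (p : ℝ) : ℝ :=
  (∑ α : Fin m → Fin n, ∑ coin : Fin m → Bool,
    if AllPark α coin then (lastPref α : ℝ) * outcomeProb p α coin else 0) / probAllPark m n p

end ProbParking

/-! The fate of the last car depends on the past only through the set `S` of spots occupied by the
first `k = m - 1` cars. It fails exactly when it prefers a spot of the run at the end of the street
and tosses heads, or a spot of the run at the start and tosses tails. Hence numerator and
denominator of the conditional expectation are linear combinations of moments, of order at most two,
of the lengths of these two runs.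

The law of these lengths is explicit. Parts of `S` separated by a free spot fill independently
(`blockWeight_union`), and a full block of `s` spots has normalised weight `(s + 1) ^ (s - 1) / s!`,
whatever `p` is (`blockWeight_Ico`). Cutting `S` after its initial run turns total weights into
convolutions of Abel polynomials, which Abel's identity evaluates. The law is free of `p` and
reversing the street swaps `p` with `1 - p`, so both runs have the same law
(`sum_fillWeight_mul_lastRun`); `p` survives only in a factor `2p - 1`.

The result is the exact formula `condExpLastPref_succ_eq`: `(n + 1)/2 - (2p - 1)/2 * (k + 1 - D)/(n
- k)` with `D = ∑ (l + 1) k(k - 1)⋯(k - l + 1)/(n + 1)^l`. For `k + 1 = cn` the quotients tend to `c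
^ l`, so `D = 1/(1 - c)^2 + O(1/n)` (`exists_abs_descSum_sub_le`), and expanding in `1/n` gives the
claim. -/

namespace ProbParking

open Finset Nat

/-! ### Abel polynomials and their convolutions -/

/-- The Abel polynomial `x (x + k) ^ (k - 1) / k!`. -/
noncomputable def abelA (x : ℝ) : ℕ → ℝ
  | 0 => 1
  | k + 1 => x * (x + (k + 1 : ℕ)) ^ k / (k + 1)!

/-- The polynomial `(x + k) ^ (k - l) / (k - l)!`, taken to be zero for `k < l`. -/
noncomputable def abelC (l : ℕ) (x : ℝ) (k : ℕ) : ℝ :=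
  if l ≤ k then (x + k) ^ (k - l) / (k - l)! else 0

lemma abelC_zero_left (x : ℝ) (k : ℕ) : abelC 0 x k = (x + k) ^ k / k ! := by
  simp [abelC]

lemma abelC_succ_zero (l : ℕ) (x : ℝ) : abelC (l + 1) x 0 = 0 := by
  simp [abelC]

lemma abelC_succ_succ (l : ℕ) (x : ℝ) (k : ℕ) :
    abelC (l + 1) x (k + 1) = abelC l (x + 1) k := by
  simp only [abelC, Nat.add_le_add_iff_right, Nat.add_sub_add_right, Nat.cast_add, Nat.cast_one]
  congr 3
  ring

lemma abelC_of_le {l k : ℕ} (h : l ≤ k) (x : ℝ) :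
    abelC l x k = (x + k) ^ (k - l) / (k - l)! := if_pos h

lemma abelC_of_lt {l k : ℕ} (h : k < l) (x : ℝ) : abelC l x k = 0 := if_neg (by omega)

lemma abelA_mul_add (x : ℝ) (k : ℕ) : abelA x k * (x + k) = x * (x + k) ^ k / k ! := by
  cases k with
  | zero => simp [abelA]
  | succ k => rw [abelA]; ring

lemma abelA_eq_sub (x : ℝ) (k : ℕ) : abelA x k = abelC 0 x k - abelC 1 x k := by
  cases k with
  | zero => simp [abelA, abelC]
  | succ k =>
    rw [abelC_zero_left, abelC_of_le (by omega), abelA, Nat.add_sub_cancel, Nat.factorial_succ]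
    have h1 : (k ! : ℝ) ≠ 0 := by positivity
    push_cast
    field_simp
    ring

lemma hasDerivAt_abelC (x : ℝ) (k : ℕ) :
    HasDerivAt (fun z => abelC 0 z k) (abelC 1 x k) x := by
  cases k with
  | zero => simpa [abelC] using hasDerivAt_const x (1 : ℝ)
  | succ k =>
    have h := (((hasDerivAt_id x).add_const ((k + 1 : ℕ) : ℝ)).pow (k + 1)).div_const
      ((k + 1)! : ℝ)
    have h1 : (k ! : ℝ) ≠ 0 := by positivity
    rw [abelC_of_le (by omega), Nat.add_sub_cancel]
    simp only [abelC_zero_left]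
    refine h.congr_deriv ?_
    rw [Nat.factorial_succ, Nat.add_sub_cancel]
    push_cast
    field_simp
    simp

lemma sum_antidiagonal_alternating_pow (k : ℕ) (y : ℝ) :
    ∑ q ∈ antidiagonal (k + 1), (-1 : ℝ) ^ q.2 * (y + q.1) ^ k / (q.1 ! * q.2 !) = 0 := by
  have h := congrFun (fwdDiff_iter_pow_eq_zero_of_lt (R := ℝ) (Nat.lt_succ_self k)) y
  rw [fwdDiff_iter_eq_sum_shift] at h
  rw [Finset.Nat.sum_antidiagonal_eq_sum_range_succ_mk]
  have h1 : ((k + 1)! : ℝ) ≠ 0 := by positivity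
  rw [← mul_right_inj' h1, mul_zero, Finset.mul_sum]
  simp only [Pi.zero_apply] at h
  rw [← h]
  refine Finset.sum_congr rfl fun i hi => ?_
  have hi' : i ≤ k + 1 := by simpa [Nat.lt_succ_iff] using hi
  have h2 : ((k + 1).choose i : ℝ) = (k + 1)! / (i ! * (k + 1 - i)!) :=
    Nat.cast_choose ℝ hi'
  simp only [nsmul_eq_mul, mul_one, zsmul_eq_mul]
  push_cast
  rw [Nat.succ_eq_add_one, h2]
  ring

/-- **Abel's identity**. -/
lemma sum_abelA_mul_abelC_zero (k : ℕ) (x y : ℝ) :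
    ∑ q ∈ antidiagonal k, abelA y q.1 * abelC 0 x q.2 = abelC 0 (x + y) k := by
  induction k generalizing x with
  | zero => simp [abelA, abelC]
  | succ k ih =>
    set F : ℝ → ℝ := fun z =>
      ∑ q ∈ antidiagonal (k + 1), abelA y q.1 * abelC 0 z q.2 - abelC 0 (z + y) (k + 1) with hF
    have hderiv : ∀ z, HasDerivAt F 0 z := by
      intro z
      have h1 : HasDerivAt F (∑ q ∈ antidiagonal (k + 1), abelA y q.1 * abelC 1 z q.2 -
          abelC 1 (z + y) (k + 1)) z :=
        (HasDerivAt.fun_sum fun q _ => (hasDerivAt_abelC z q.2).const_mul (abelA y q.1)).sub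
          ((hasDerivAt_abelC (z + y) (k + 1)).comp_add_const z y)
      refine h1.congr_deriv ?_
      rw [Finset.Nat.sum_antidiagonal_succ', abelC_succ_zero, abelC_succ_succ]
      simp only [abelC_succ_succ]
      rw [ih]
      ring_nf
    -- The induction hypothesis at `z + 1` makes the derivative vanish, so one good point suffices.
    -- At `z = -(k + 1) - y` the right side is zero, and `z + q.2 = -(y + q.1)` turns the left side
    -- into `y` times a finite difference of order `k + 1` of a polynomial of degree `k`.
    have hconst : F x = F (-(k + 1 : ℕ) - y) :=
      is_const_of_deriv_eq_zero (fun z => (hderiv z).differentiableAt)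
        (fun z => (hderiv z).deriv) _ _
    have hzero : F (-(k + 1 : ℕ) - y) = 0 := by
      have h1 : abelC 0 (-(k + 1 : ℕ) - y + y) (k + 1) = 0 := by
        rw [abelC_zero_left, sub_add_cancel, neg_add_cancel]
        simp
      simp only [hF, h1, sub_zero]
      rw [← mul_zero y, ← sum_antidiagonal_alternating_pow k y, Finset.mul_sum]
      refine Finset.sum_congr rfl fun q hq => ?_
      rw [Finset.HasAntidiagonal.mem_antidiagonal] at hq
      have h2 : (-((k + 1 : ℕ) : ℝ) - y + q.2) = -(y + q.1) := by
        rw [← hq]; push_cast; ring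
      rw [abelC_zero_left, h2, neg_pow]
      rcases Nat.eq_zero_or_pos q.2 with h0 | h0
      · have h3 : q.1 = k + 1 := by omega
        rw [h0, h3, abelA]
        simp
        ring
      · obtain ⟨j, hj⟩ : ∃ j, q.2 = j + 1 := ⟨q.2 - 1, by omega⟩
        have h3 : k = q.1 + j := by omega
        have h4 := abelA_mul_add y q.1
        rw [hj, h3, pow_succ (y + (q.1 : ℝ)), pow_add (y + (q.1 : ℝ))]
        calc abelA y q.1 * ((-1) ^ (j + 1) * ((y + q.1) ^ j * (y + q.1)) / (j + 1)!)
            = (abelA y q.1 * (y + q.1)) * ((-1) ^ (j + 1) * (y + q.1) ^ j / (j + 1)!) := by ring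
          _ = _ := by
            rw [h4]
            have h5 : (q.1 ! : ℝ) ≠ 0 := by positivity
            have h6 : ((j + 1)! : ℝ) ≠ 0 := by positivity
            field_simp
    have := hconst.trans hzero
    simp only [hF] at this
    linarith

lemma sum_abelA_mul_abelC (l k : ℕ) (x y : ℝ) :
    ∑ q ∈ antidiagonal k, abelA y q.1 * abelC l x q.2 = abelC l (x + y) k := by
  induction l generalizing k x with
  | zero => exact sum_abelA_mul_abelC_zero k x y
  | succ l ih =>
    cases k with
    | zero => simp [abelC]
    | succ k =>
      rw [Finset.Nat.sum_antidiagonal_succ', abelC_succ_zero, abelC_succ_succ]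
      simp only [abelC_succ_succ]
      rw [ih]
      ring_nf

lemma sum_abelC_mul_abelA (l k : ℕ) (x y : ℝ) :
    ∑ q ∈ antidiagonal k, abelC l x q.1 * abelA y q.2 = abelC l (x + y) k := by
  rw [← sum_abelA_mul_abelC, ← Finset.Nat.sum_antidiagonal_swap]
  exact Finset.sum_congr rfl fun q _ => mul_comm _ _

lemma sum_abelA_mul_abelA (k : ℕ) (x y : ℝ) :
    ∑ q ∈ antidiagonal k, abelA x q.1 * abelA y q.2 = abelA (x + y) k := by
  simp only [abelA_eq_sub x, sub_mul, Finset.sum_sub_distrib, sum_abelC_mul_abelA]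
  rw [abelA_eq_sub]

/-- Weighting by the block length stays within the `abelC` family, whose convolutions with `abelA`
are known. -/
lemma natCast_mul_abelA_one (k : ℕ) : k * abelA 1 k = abelC 1 1 k := by
  cases k with
  | zero => simp [abelC]
  | succ k =>
    rw [abelC_of_le (by omega), abelA, Nat.add_sub_cancel, Nat.factorial_succ]
    have h1 : (k ! : ℝ) ≠ 0 := by positivity
    push_cast
    field_simp

/-- The sum telescopes, because `(1 + k) * abelC (l + 1) 1 k = (k - l) * abelC l 1 k` for `l ≤ k`.
-/
lemma sum_range_succ_mul_abelC (k n : ℕ) (hk : k ≤ n) :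
    ∑ l ∈ range (n + 1), ((l : ℝ) + 1) * abelC l 1 k = (1 + k) * abelC 0 1 k := by
  have h : ∀ l : ℕ, ((l : ℝ) + 1) * abelC l 1 k =
      (1 + k) * abelC l 1 k - (1 + k) * abelC (l + 1) 1 k := by
    intro l
    rcases lt_trichotomy l k with h | rfl | h
    · obtain ⟨j, rfl⟩ : ∃ j, k = l + 1 + j := ⟨k - (l + 1), by omega⟩
      rw [abelC_of_le (by omega), abelC_of_le (by omega),
        show l + 1 + j - l = j + 1 by omega, show l + 1 + j - (l + 1) = j by omega,
        Nat.factorial_succ]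
      have h1 : (j ! : ℝ) ≠ 0 := by positivity
      push_cast
      field_simp
      ring
    · rw [abelC_of_le le_rfl, abelC_of_lt (by omega)]
      simp
      ring
    · rw [abelC_of_lt h, abelC_of_lt (by omega)]
      simp
  rw [Finset.sum_congr rfl fun l _ => h l, Finset.sum_range_sub', abelC_of_lt (by omega : k < n + 1)]
  ring

/-- The coefficients do not depend on `k`, and the cutoff `n` can be shared by all terms of a
convolution, so each `abelC l` can be convolved separately. -/
lemma natCast_sq_mul_abelA_one (k n : ℕ) (hk : k ≤ n) :
    (k : ℝ) ^ 2 * abelA 1 k =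
      ∑ l ∈ range (n + 1), ((l : ℝ) + 1) * abelC l 1 k - abelC 0 1 k - abelC 1 1 k := by
  rw [sum_range_succ_mul_abelC k n hk, ← natCast_mul_abelA_one]
  have h := abelA_mul_add 1 k
  rw [abelC_zero_left]
  linear_combination (k : ℝ) * h

/-- Zeroth moment of the Abel distribution. -/
lemma sum_abelA_one_mul_abelA (k : ℕ) (y : ℝ) :
    ∑ q ∈ antidiagonal k, abelA 1 q.1 * abelA y q.2 = abelA (1 + y) k :=
  sum_abelA_mul_abelA k 1 y

/-- First moment of the Abel distribution. -/
lemma sum_natCast_mul_abelA_one_mul_abelA (k : ℕ) (y : ℝ) :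
    ∑ q ∈ antidiagonal k, (q.1 : ℝ) * (abelA 1 q.1 * abelA y q.2) = abelC 1 (1 + y) k := by
  simp only [← mul_assoc, natCast_mul_abelA_one, sum_abelC_mul_abelA]

/-- Second moment of the Abel distribution. -/
lemma sum_natCast_sq_mul_abelA_one_mul_abelA (k : ℕ) (y : ℝ) :
    ∑ q ∈ antidiagonal k, (q.1 : ℝ) ^ 2 * (abelA 1 q.1 * abelA y q.2) =
      ∑ l ∈ range (k + 1), ((l : ℝ) + 1) * abelC l (1 + y) k - abelC 0 (1 + y) k -
        abelC 1 (1 + y) k := by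
  have h : ∀ q ∈ antidiagonal k, (q.1 : ℝ) ^ 2 * (abelA 1 q.1 * abelA y q.2) =
      ∑ l ∈ range (k + 1), ((l : ℝ) + 1) * (abelC l 1 q.1 * abelA y q.2) -
        abelC 0 1 q.1 * abelA y q.2 - abelC 1 1 q.1 * abelA y q.2 := by
    intro q hq
    rw [Finset.HasAntidiagonal.mem_antidiagonal] at hq
    rw [← mul_assoc, natCast_sq_mul_abelA_one q.1 k (by omega), sub_mul, sub_mul, Finset.sum_mul]
    simp only [mul_assoc]
  rw [Finset.sum_congr rfl h, Finset.sum_sub_distrib, Finset.sum_sub_distrib, Finset.sum_comm]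
  simp only [← Finset.mul_sum, sum_abelC_mul_abelA]

/-! ### Filling weights and independence of separated parts -/

section Runs

variable {α : Type*} [LinearOrder α]

open scoped Classical in
/-- The maximal run of consecutive elements of `S` that ends just before `x`. -/
noncomputable def leftRun (S : Finset α) (x : α) : Finset α :=
  S.filter fun a => a < x ∧ ∀ b, a ≤ b → b < x → b ∈ S

open scoped Classical in
/-- The maximal run of consecutive elements of `S` that starts just after `x`. -/
noncomputable def rightRun (S : Finset α) (x : α) : Finset α :=
  S.filter fun a => x < a ∧ ∀ b, x < b → b ≤ a → b ∈ S

lemma mem_leftRun {S : Finset α} {x a : α} :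
    a ∈ leftRun S x ↔ a ∈ S ∧ a < x ∧ ∀ b, a ≤ b → b < x → b ∈ S := by
  simp [leftRun]

lemma mem_rightRun {S : Finset α} {x a : α} :
    a ∈ rightRun S x ↔ a ∈ S ∧ x < a ∧ ∀ b, x < b → b ≤ a → b ∈ S := by
  simp [rightRun]

/-- The weight of the preferences and coins that send a car to the free spot `x` when the
occupied spots are those of `S`. -/
noncomputable def parkWeight (p : ℝ) (S : Finset α) (x : α) : ℝ :=
  1 + p * #(leftRun S x) + (1 - p) * #(rightRun S x)

/-- The weight of the ways in which `k` cars, one after the other, fill the set `T`. -/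
noncomputable def fillWeight (p : ℝ) : ℕ → Finset α → ℝ
  | 0, T => if T = ∅ then 1 else 0
  | k + 1, T => ∑ x ∈ T, fillWeight p k (T.erase x) * parkWeight p (T.erase x) x

/-- The weight of the ways to fill the set `T`, divided by the number of orders of the cars. -/
noncomputable def blockWeight (p : ℝ) (T : Finset α) : ℝ :=
  fillWeight p #T T / (#T)!

lemma fillWeight_of_card_ne (p : ℝ) {k : ℕ} {T : Finset α} (h : #T ≠ k) :
    fillWeight p k T = 0 := by
  induction k generalizing T with
  | zero => rw [fillWeight, if_neg (by rintro rfl; simp at h)]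
  | succ k ih =>
    rw [fillWeight]
    refine Finset.sum_eq_zero fun x hx => ?_
    rw [ih (by rw [Finset.card_erase_of_mem hx]; have := Finset.card_pos.2 ⟨x, hx⟩; omega), zero_mul]

lemma fillWeight_card (p : ℝ) (T : Finset α) :
    fillWeight p #T T = (#T)! * blockWeight p T := by
  have : ((#T)! : ℝ) ≠ 0 := by positivity
  rw [blockWeight]
  field_simp

lemma blockWeight_empty (p : ℝ) : blockWeight p (∅ : Finset α) = 1 := by
  simp [blockWeight, fillWeight]

/-- Recursion on the last spot filled. Division by the number of orders puts it in the form of a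
Leibniz rule, which products over separated parts respect. -/
lemma card_mul_blockWeight (p : ℝ) (T : Finset α) :
    #T * blockWeight p T = ∑ x ∈ T, blockWeight p (T.erase x) * parkWeight p (T.erase x) x := by
  rcases T.eq_empty_or_nonempty with rfl | hT
  · simp
  obtain ⟨k, hk⟩ : ∃ k, #T = k + 1 := ⟨#T - 1, by have := hT.card_pos; omega⟩
  rw [blockWeight, hk, fillWeight, Nat.factorial_succ, ← mul_div_assoc, Finset.mul_sum,
    Finset.sum_div]
  refine Finset.sum_congr rfl fun x hx => ?_
  rw [blockWeight, Finset.card_erase_of_mem hx, hk, Nat.add_sub_cancel]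
  have h1 : (k ! : ℝ) ≠ 0 := by positivity
  push_cast
  field_simp

lemma parkWeight_union_left (p : ℝ) {A B : Finset α} {e x : α} (hA : ∀ a ∈ A, a < e)
    (hB : ∀ b ∈ B, e < b) (hx : x < e) : parkWeight p (A ∪ B) x = parkWeight p A x := by
  have h1 : leftRun (A ∪ B) x = leftRun A x := by
    ext a
    simp only [mem_leftRun, Finset.mem_union]
    grind
  have h2 : rightRun (A ∪ B) x = rightRun A x := by
    ext a
    simp only [mem_rightRun, Finset.mem_union]
    constructor
    · rintro ⟨-, h, h'⟩
      have hae : a < e := by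
        by_contra hae
        rcases h' e hx (not_lt.1 hae) with h' | h'
        exacts [lt_irrefl _ (hA _ h'), lt_irrefl _ (hB _ h')]
      have key : ∀ b, x < b → b ≤ a → b ∈ A := fun b hb hb' =>
        (h' b hb hb').resolve_right fun hbB => lt_asymm (hB b hbB) (hb'.trans_lt hae)
      exact ⟨key a h le_rfl, h, key⟩
    · rintro ⟨h, h', h''⟩
      exact ⟨Or.inl h, h', fun b hb hb' => Or.inl (h'' b hb hb')⟩
  rw [parkWeight, parkWeight, h1, h2]

lemma parkWeight_union_right (p : ℝ) {A B : Finset α} {e x : α} (hA : ∀ a ∈ A, a < e)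
    (hB : ∀ b ∈ B, e < b) (hx : e < x) : parkWeight p (A ∪ B) x = parkWeight p B x := by
  have h1 : rightRun (A ∪ B) x = rightRun B x := by
    ext a
    simp only [mem_rightRun, Finset.mem_union]
    grind
  have h2 : leftRun (A ∪ B) x = leftRun B x := by
    ext a
    simp only [mem_leftRun, Finset.mem_union]
    constructor
    · rintro ⟨-, h, h'⟩
      have hae : e < a := by
        by_contra hae
        rcases h' e (not_lt.1 hae) hx with h' | h'
        exacts [lt_irrefl _ (hA _ h'), lt_irrefl _ (hB _ h')]
      have key : ∀ b, a ≤ b → b < x → b ∈ B := fun b hb hb' =>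
        (h' b hb hb').resolve_left fun hbA => lt_asymm (hA b hbA) (hae.trans_le hb)
      exact ⟨key a le_rfl h, h, key⟩
    · rintro ⟨h, h', h''⟩
      exact ⟨Or.inr h, h', fun b hb hb' => Or.inr (h'' b hb hb')⟩
  rw [parkWeight, parkWeight, h1, h2]

/-- Parts separated by a free spot are filled independently. -/
lemma blockWeight_union (p : ℝ) {A B : Finset α} {e : α} (hA : ∀ a ∈ A, a < e)
    (hB : ∀ b ∈ B, e < b) : blockWeight p (A ∪ B) = blockWeight p A * blockWeight p B := by
  induction hk : #A + #B generalizing A B with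
  | zero =>
    obtain ⟨rfl, rfl⟩ : A = ∅ ∧ B = ∅ := by simpa using hk
    simp [blockWeight_empty]
  | succ k ih =>
    have hdisj : Disjoint A B := Finset.disjoint_left.2 fun x hx hx' =>
      lt_asymm (hA x hx) (hB x hx')
    have hcard : #(A ∪ B) = #A + #B := Finset.card_union_of_disjoint hdisj
    have hne : ((#(A ∪ B) : ℕ) : ℝ) ≠ 0 := by rw [hcard, hk]; positivity
    refine mul_left_cancel₀ hne ?_
    rw [card_mul_blockWeight, Finset.sum_union hdisj]
    -- A last car parking in `A` sees no run across the free spot `e`, so `B` contributes only a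
    -- factor.
    have h1 : ∀ x ∈ A, blockWeight p ((A ∪ B).erase x) * parkWeight p ((A ∪ B).erase x) x =
        blockWeight p (A.erase x) * parkWeight p (A.erase x) x * blockWeight p B := by
      intro x hx
      have hxB : x ∉ B := Finset.disjoint_left.1 hdisj hx
      have hA' : ∀ a ∈ A.erase x, a < e := fun a ha => hA a (Finset.mem_of_mem_erase ha)
      rw [Finset.erase_union_distrib, Finset.erase_eq_of_notMem hxB,
        parkWeight_union_left p hA' hB (hA x hx), ih hA' hB
          (by rw [Finset.card_erase_of_mem hx]; have := Finset.card_pos.2 ⟨x, hx⟩; omega)]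
      ring
    have h2 : ∀ x ∈ B, blockWeight p ((A ∪ B).erase x) * parkWeight p ((A ∪ B).erase x) x =
        blockWeight p (B.erase x) * parkWeight p (B.erase x) x * blockWeight p A := by
      intro x hx
      have hxA : x ∉ A := Finset.disjoint_right.1 hdisj hx
      have hB' : ∀ b ∈ B.erase x, e < b := fun b hb => hB b (Finset.mem_of_mem_erase hb)
      rw [Finset.erase_union_distrib, Finset.erase_eq_of_notMem hxA,
        parkWeight_union_right p hA hB' (hB x hx), ih hA hB'
          (by rw [Finset.card_erase_of_mem hx]; have := Finset.card_pos.2 ⟨x, hx⟩; omega)]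
      ring
    rw [Finset.sum_congr rfl h1, Finset.sum_congr rfl h2, ← Finset.sum_mul, ← Finset.sum_mul,
      ← card_mul_blockWeight, ← card_mul_blockWeight, hcard]
    push_cast
    ring

end Runs

/-! ### Weight of a full block -/

lemma Ico_erase_eq_union (a i j : ℕ) :
    (Ico a (a + (i + j + 1))).erase (a + i) = Ico a (a + i) ∪ Ico (a + i + 1) (a + i + 1 + j) := by
  ext x
  simp only [Finset.mem_erase, Finset.mem_union, Finset.mem_Ico]
  omega

lemma parkWeight_Ico_erase (p : ℝ) (a i j : ℕ) :
    parkWeight p ((Ico a (a + (i + j + 1))).erase (a + i)) (a + i) = 1 + p * i + (1 - p) * j := by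
  have h1 : leftRun ((Ico a (a + (i + j + 1))).erase (a + i)) (a + i) = Ico a (a + i) := by
    ext x
    simp only [mem_leftRun, Finset.mem_erase, Finset.mem_Ico]
    constructor
    · omega
    · intro h
      refine ⟨by omega, by omega, fun b _ _ => by omega⟩
  have h2 : rightRun ((Ico a (a + (i + j + 1))).erase (a + i)) (a + i) =
      Ico (a + i + 1) (a + i + 1 + j) := by
    ext x
    simp only [mem_rightRun, Finset.mem_erase, Finset.mem_Ico]
    constructor
    · omega
    · intro h
      refine ⟨by omega, by omega, fun b _ _ => by omega⟩
  simp [parkWeight, h1, h2]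

/-- The last spot filled splits the block into parts of sizes `i` and `j`, with factor `1 + p i + (1
- p) j`. Exchanging `i` and `j` shows that both linear terms have the same sum, so `p` cancels and
Abel's identity closes the recursion. -/
lemma blockWeight_Ico (p : ℝ) (a s : ℕ) : blockWeight p (Ico a (a + s)) = abelA 1 s := by
  induction s using Nat.strong_induction_on generalizing a with
  | _ s ih =>
    cases s with
    | zero => simp [blockWeight_empty, abelA]
    | succ k =>
      have hne : ((k + 1 : ℕ) : ℝ) ≠ 0 := by positivity
      refine mul_left_cancel₀ hne ?_
      have h := card_mul_blockWeight p (Ico a (a + (k + 1)))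
      rw [Nat.card_Ico, Nat.add_sub_cancel_left, Finset.sum_Ico_eq_sum_range,
        Nat.add_sub_cancel_left] at h
      rw [h]
      have h1 : ∀ i ∈ range (k + 1), blockWeight p ((Ico a (a + (k + 1))).erase (a + i)) *
          parkWeight p ((Ico a (a + (k + 1))).erase (a + i)) (a + i) =
          (fun q : ℕ × ℕ => abelA 1 q.1 * abelA 1 q.2 * (1 + p * q.1 + (1 - p) * q.2))
            (i, k - i) := by
        intro i hi
        obtain ⟨j, rfl⟩ : ∃ j, k = i + j := ⟨k - i, by have := Finset.mem_range.1 hi; omega⟩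
        rw [parkWeight_Ico_erase, Ico_erase_eq_union, blockWeight_union p (e := a + i)
          (by simp) (by simp; omega), ih i (by omega), ih j (by omega), Nat.add_sub_cancel_left]
      refine (Finset.sum_congr rfl h1).trans
        ((Finset.Nat.sum_antidiagonal_eq_sum_range_succ_mk (fun q : ℕ × ℕ =>
          abelA 1 q.1 * abelA 1 q.2 * (1 + p * q.1 + (1 - p) * q.2)) k).symm.trans ?_)
      rw [natCast_mul_abelA_one, abelC_succ_succ]
      have h2 : ∑ q ∈ antidiagonal k, abelA 1 q.1 * abelA 1 q.2 * (1 + p * q.1 + (1 - p) * q.2) =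
          abelA (1 + 1) k + abelC 1 (1 + 1) k := by
        have h3 : ∑ q ∈ antidiagonal k, (q.2 : ℝ) * (abelA 1 q.1 * abelA 1 q.2) =
            abelC 1 (1 + 1) k := by
          rw [← sum_natCast_mul_abelA_one_mul_abelA, ← Finset.Nat.sum_antidiagonal_swap]
          exact Finset.sum_congr rfl fun q _ => by simp only [Prod.fst_swap, Prod.snd_swap]; ring
        calc _ = ∑ q ∈ antidiagonal k, abelA 1 q.1 * abelA 1 q.2 +
              p * ∑ q ∈ antidiagonal k, (q.1 : ℝ) * (abelA 1 q.1 * abelA 1 q.2) +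
              (1 - p) * ∑ q ∈ antidiagonal k, (q.2 : ℝ) * (abelA 1 q.1 * abelA 1 q.2) := by
              simp only [Finset.mul_sum, ← Finset.sum_add_distrib]
              exact Finset.sum_congr rfl fun q _ => by ring
          _ = _ := by
              rw [h3, sum_natCast_mul_abelA_one_mul_abelA, sum_abelA_one_mul_abelA]
              ring
      rw [h2, abelA_eq_sub]
      ring

/-! ### Decomposition by the initial run -/

open scoped Classical in
/-- The maximal run of consecutive elements of `T` that starts at `a`. -/
noncomputable def runFrom (a : ℕ) (T : Finset ℕ) : Finset ℕ :=
  T.filter fun t => a ≤ t ∧ ∀ b, a ≤ b → b ≤ t → b ∈ T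

lemma runFrom_Ico_union (a s : ℕ) {T : Finset ℕ} (hT : ∀ t ∈ T, a + s < t) :
    runFrom a (Ico a (a + s) ∪ T) = Ico a (a + s) := by
  ext x
  simp only [runFrom, Finset.mem_filter, Finset.mem_union, Finset.mem_Ico]
  constructor
  · rintro ⟨-, h, h'⟩
    refine ⟨h, ?_⟩
    by_contra hx
    rcases h' (a + s) (by omega) (by omega) with h' | h'
    · omega
    · exact lt_irrefl _ (hT _ h')
  · intro h
    exact ⟨Or.inl h, h.1, fun b hb hb' => Or.inl ⟨hb, by omega⟩⟩

lemma exists_eq_Ico_union (a : ℕ) (T : Finset ℕ) (hT : ∀ t ∈ T, a ≤ t) :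
    ∃ s, a + s ∉ T ∧ T = Ico a (a + s) ∪ T.filter (a + s < ·) := by
  have hex : ∃ s, a + s ∉ T := by
    obtain ⟨b, hb⟩ := Infinite.exists_notMem_finset (T ∪ range a)
    simp only [Finset.mem_union, Finset.mem_range, not_or, not_lt] at hb
    exact ⟨b - a, by rw [Nat.add_sub_cancel' hb.2]; exact hb.1⟩
  classical
  refine ⟨Nat.find hex, Nat.find_spec hex, ?_⟩
  ext x
  simp only [Finset.mem_union, Finset.mem_Ico, Finset.mem_filter]
  constructor
  · intro hx
    have hax := hT x hx
    rcases lt_trichotomy x (a + Nat.find hex) with h | h | h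
    · exact Or.inl ⟨hax, h⟩
    · exact absurd (h ▸ hx) (Nat.find_spec hex)
    · exact Or.inr ⟨hx, h⟩
  · rintro (⟨h, h'⟩ | ⟨h, -⟩)
    · have := Nat.find_min hex (m := x - a) (by omega)
      rwa [not_not, Nat.add_sub_cancel' h] at this
    · exact h

lemma filter_Ico_union (a s : ℕ) {T : Finset ℕ} (hT : ∀ t ∈ T, a + s < t) :
    (Ico a (a + s) ∪ T).filter (a + s < ·) = T := by
  ext x
  simp only [Finset.mem_filter, Finset.mem_union, Finset.mem_Ico]
  have := hT x
  grind

/-- Sets with fewer elements than the interval are sorted by the length of their initial run. -/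
lemma sum_powersetCard_Ico {n M : ℕ} (hM : M < n) (a : ℕ) (Φ : Finset ℕ → ℝ) :
    ∑ T ∈ powersetCard M (Ico a (a + n)), Φ T =
      ∑ q ∈ antidiagonal M, ∑ T ∈ powersetCard q.2 (Ico (a + q.1 + 1) (a + n)),
        Φ (Ico a (a + q.1) ∪ T) := by
  rw [Finset.sum_sigma', eq_comm]
  have hlt : ∀ q : ℕ × ℕ, ∀ T ∈ powersetCard q.2 (Ico (a + q.1 + 1) (a + n)),
      ∀ t ∈ T, a + q.1 < t := by
    intro q T hT t ht
    have := Finset.mem_Ico.1 ((Finset.mem_powersetCard.1 hT).1 ht)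
    omega
  refine Finset.sum_bij (fun x _ => Ico a (a + x.1.1) ∪ x.2) ?_ ?_ ?_ fun _ _ => rfl
  · rintro ⟨q, T⟩ hx
    simp only [Finset.mem_sigma, Finset.HasAntidiagonal.mem_antidiagonal] at hx
    dsimp only
    have hT := Finset.mem_powersetCard.1 hx.2
    refine Finset.mem_powersetCard.2 ⟨Finset.union_subset ?_ ?_, ?_⟩
    · exact Finset.Ico_subset_Ico_right (by omega)
    · exact hT.1.trans (Finset.Ico_subset_Ico_left (by omega))
    · rw [Finset.card_union_of_disjoint, Nat.card_Ico, hT.2]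
      · omega
      · refine Finset.disjoint_left.2 fun x h h' => ?_
        have := hlt q T hx.2 x h'
        have := Finset.mem_Ico.1 h
        omega
  · rintro ⟨⟨s, j⟩, T⟩ hx ⟨⟨s', j'⟩, T'⟩ hx' h
    simp only [Finset.mem_sigma, Finset.HasAntidiagonal.mem_antidiagonal] at hx hx' h
    have h1 := hlt (s, j) T hx.2
    have h2 := hlt (s', j') T' hx'.2
    -- The length of the initial run recovers the cut point.
    have hs : s = s' := by
      have := congrArg (fun U => #(runFrom a U)) h
      simpa only [runFrom_Ico_union a s h1, runFrom_Ico_union a s' h2, Nat.card_Ico,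
        Nat.add_sub_cancel_left] using this
    subst hs
    obtain rfl : j = j' := by omega
    have hT : T = T' := by
      rw [← filter_Ico_union a s h1, ← filter_Ico_union a s h2, h]
    rw [hT]
  · intro T hT
    obtain ⟨hT, hcard⟩ := Finset.mem_powersetCard.1 hT
    obtain ⟨s, hs, hU⟩ := exists_eq_Ico_union a T fun t ht => (Finset.mem_Ico.1 (hT ht)).1
    have hc : M = s + #(T.filter (a + s < ·)) := by
      rw [← hcard]
      conv_lhs => rw [hU]
      rw [Finset.card_union_of_disjoint, Nat.card_Ico, Nat.add_sub_cancel_left]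
      refine Finset.disjoint_left.2 fun x h h' => ?_
      have := (Finset.mem_filter.1 h').2
      have := Finset.mem_Ico.1 h
      omega
    refine ⟨⟨(s, #(T.filter (a + s < ·))), T.filter (a + s < ·)⟩, ?_, hU.symm⟩
    simp only [Finset.mem_sigma, Finset.HasAntidiagonal.mem_antidiagonal,
      Finset.mem_powersetCard, and_true]
    refine ⟨hc.symm, fun x hx => ?_⟩
    have h1 := Finset.mem_filter.1 hx
    have h2 := Finset.mem_Ico.1 (hT h1.1)
    exact Finset.mem_Ico.2 ⟨h1.2, h2.2⟩

lemma blockWeight_Ico_union (p : ℝ) (a s : ℕ) {T : Finset ℕ} (hT : ∀ t ∈ T, a + s < t) :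
    blockWeight p (Ico a (a + s) ∪ T) = abelA 1 s * blockWeight p T := by
  rw [blockWeight_union p (e := a + s) (fun x hx => (Finset.mem_Ico.1 hx).2) hT, blockWeight_Ico]

/-- The total weight of the sets of `M` occupied spots in an interval of length `n`. -/
lemma sum_blockWeight (p : ℝ) {n M : ℕ} (hM : M ≤ n) (a : ℕ) :
    ∑ T ∈ powersetCard M (Ico a (a + n)), blockWeight p T = abelA (n + 1 - M) M := by
  induction n using Nat.strong_induction_on generalizing a M with
  | _ n ih =>
    rcases hM.eq_or_lt with rfl | hlt
    · have h : powersetCard M (Ico a (a + M)) = {Ico a (a + M)} := by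
        have := Finset.powersetCard_self (Ico a (a + M))
        rwa [Nat.card_Ico, Nat.add_sub_cancel_left] at this
      rw [h, Finset.sum_singleton, blockWeight_Ico]
      congr 1
      ring
    · rw [sum_powersetCard_Ico hlt]
      have h : ∀ q ∈ antidiagonal M, ∑ T ∈ powersetCard q.2 (Ico (a + q.1 + 1) (a + n)),
          blockWeight p (Ico a (a + q.1) ∪ T) = abelA 1 q.1 * abelA (n - M) q.2 := by
        intro q hq
        rw [Finset.HasAntidiagonal.mem_antidiagonal] at hq
        obtain ⟨r, hr⟩ : ∃ r, n = q.1 + 1 + r := ⟨n - (q.1 + 1), by omega⟩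
        have h1 : a + n = a + q.1 + 1 + r := by omega
        -- Removing the run and the free spot after it leaves an Abel parameter that does not depend
        -- on `q`; this is what makes the sum a convolution.
        have h2 : ((r : ℝ) + 1 - q.2) = n - M := by
          rw [hr, ← hq]; push_cast; ring
        rw [h1, ← h2, ← ih r (by omega) (by omega) (a + q.1 + 1), Finset.mul_sum]
        refine Finset.sum_congr rfl fun T hT => blockWeight_Ico_union p a q.1 fun t ht => ?_
        have := Finset.mem_Ico.1 ((Finset.mem_powersetCard.1 hT).1 ht)
        omega
      rw [Finset.sum_congr rfl h, sum_abelA_one_mul_abelA]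
      congr 1
      ring

/-- The joint law of the weight and the length of the initial run. -/
lemma sum_blockWeight_mul (p : ℝ) {n M : ℕ} (hM : M < n) (a : ℕ) (f : ℕ → ℝ) :
    ∑ T ∈ powersetCard M (Ico a (a + n)), f #(runFrom a T) * blockWeight p T =
      ∑ q ∈ antidiagonal M, f q.1 * (abelA 1 q.1 * abelA (n - M) q.2) := by
  rw [sum_powersetCard_Ico hM]
  refine Finset.sum_congr rfl fun q hq => ?_
  rw [Finset.HasAntidiagonal.mem_antidiagonal] at hq
  obtain ⟨r, hr⟩ : ∃ r, n = q.1 + 1 + r := ⟨n - (q.1 + 1), by omega⟩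
  have h1 : a + n = a + q.1 + 1 + r := by omega
  have h2 : ((r : ℝ) + 1 - q.2) = n - M := by
    rw [hr, ← hq]; push_cast; ring
  rw [h1, ← h2, ← sum_blockWeight p (by omega : q.2 ≤ r) (a + q.1 + 1), Finset.mul_sum,
    Finset.mul_sum]
  refine Finset.sum_congr rfl fun T hT => ?_
  have hlt : ∀ t ∈ T, a + q.1 < t := fun t ht => by
    have := Finset.mem_Ico.1 ((Finset.mem_powersetCard.1 hT).1 ht)
    omega
  rw [blockWeight_Ico_union p a q.1 hlt, runFrom_Ico_union a q.1 hlt, Nat.card_Ico,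
    Nat.add_sub_cancel_left]

/-! ### From the parking process to filling weights -/

/-- The probability of the outcome `c` of a coin with heads probability `p`. -/
def coinWeight (p : ℝ) (c : Bool) : ℝ := if c = true then p else 1 - p

/-- The weight of the outcomes in which `k` cars park and occupy exactly the spots of `T`. -/
noncomputable def stateWeight {n : ℕ} (p : ℝ) (k : ℕ) (T : Finset (Fin n)) : ℝ :=
  ∑ α : Fin k → Fin n, ∑ coin : Fin k → Bool,
    if occupied k α coin = some T then ∏ i, coinWeight p (coin i) else 0

lemma sum_fin_succ_pi {β : Type*} [Fintype β] [DecidableEq β] {k : ℕ}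
    (g : (Fin k → β) → β → ℝ) :
    ∑ α : Fin (k + 1) → β, g (fun i => α i.castSucc) (α (Fin.last k)) =
      ∑ α : Fin k → β, ∑ a, g α a := by
  rw [← (Fin.snocEquiv fun _ : Fin (k + 1) => β).sum_comp, Fintype.sum_prod_type,
    Finset.sum_comm]
  simp [Fin.snocEquiv]

/-- Conditioning on the spots occupied before the last car arrives. -/
lemma sum_outcomes_succ {n : ℕ} (p : ℝ) (k : ℕ) (Φ : Finset (Fin n) → Fin n → Bool → ℝ) :
    ∑ α : Fin (k + 1) → Fin n, ∑ coin : Fin (k + 1) → Bool,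
      (occupied k (fun i => α i.castSucc) (fun i => coin i.castSucc)).elim 0
        (fun S => Φ S (α (Fin.last k)) (coin (Fin.last k))) * ∏ i, coinWeight p (coin i) =
    ∑ S, stateWeight p k S * ∑ a, ∑ c, Φ S a c * coinWeight p c := by
  have h1 : ∀ α : Fin (k + 1) → Fin n, ∑ coin : Fin (k + 1) → Bool,
      (occupied k (fun i => α i.castSucc) (fun i => coin i.castSucc)).elim 0
        (fun S => Φ S (α (Fin.last k)) (coin (Fin.last k))) * ∏ i, coinWeight p (coin i) =
      ∑ coin : Fin k → Bool, ∑ c, (occupied k (fun i => α i.castSucc) coin).elim 0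
        (fun S => Φ S (α (Fin.last k)) c) * ((∏ i, coinWeight p (coin i)) * coinWeight p c) := by
    intro α
    rw [← sum_fin_succ_pi (fun (coin : Fin k → Bool) c =>
      (occupied k (fun i => α i.castSucc) coin).elim 0
        (fun S => Φ S (α (Fin.last k)) c) * ((∏ i, coinWeight p (coin i)) * coinWeight p c))]
    simp only [Fin.prod_univ_castSucc]
  simp only [h1]
  rw [sum_fin_succ_pi (fun (α : Fin k → Fin n) a => ∑ coin : Fin k → Bool, ∑ c,
    (occupied k α coin).elim 0 (fun S => Φ S a c) *
      ((∏ i, coinWeight p (coin i)) * coinWeight p c))]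
  simp only [stateWeight, Finset.sum_mul]
  rw [Finset.sum_comm (s := (Finset.univ : Finset (Finset (Fin n))))]
  refine Finset.sum_congr rfl fun α _ => ?_
  rw [Finset.sum_comm, Finset.sum_comm (s := (Finset.univ : Finset (Finset (Fin n))))]
  refine Finset.sum_congr rfl fun coin _ => ?_
  rcases h : occupied k α coin with _ | S
  · simp
  · simp only [Option.elim_some, Option.some.injEq, ite_mul, zero_mul, Finset.sum_ite_eq,
      Finset.mem_univ, if_true]
    simp only [Finset.mul_sum]
    exact Finset.sum_congr rfl fun a _ => Finset.sum_congr rfl fun c _ => by ring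

section NextSpot

variable {n : ℕ} {S : Finset (Fin n)} {a x : Fin n}

lemma notMem_of_nextSpot_eq_some {c : Bool} (h : nextSpot S a c = some x) : x ∉ S := by
  unfold nextSpot at h
  split_ifs at h with h1 h2 h3 h4
  · have := Finset.min'_mem _ h3
    rw [Option.some.inj h] at this
    exact (Finset.mem_filter.1 this).2.1
  · have := Finset.max'_mem _ h4
    rw [Option.some.inj h] at this
    exact (Finset.mem_filter.1 this).2.1
  · rwa [← Option.some.inj h]

lemma nextSpot_true_eq_some_iff (hx : x ∉ S) :
    nextSpot S a true = some x ↔ a = x ∨ a ∈ leftRun S x := by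
  rw [mem_leftRun]
  unfold nextSpot
  by_cases ha : a ∈ S
  · have hax : a ≠ x := fun h => hx (h ▸ ha)
    simp only [ha, not_true_eq_false, if_false, if_true, hax, false_or, true_and]
    split_ifs with h
    · rw [Option.some.injEq]
      constructor
      · intro hmin
        have h1 := Finset.min'_mem _ h
        rw [hmin, Finset.mem_filter] at h1
        refine ⟨h1.2.2, fun b hab hbx => ?_⟩
        by_contra hb
        have hab' : a < b := lt_of_le_of_ne hab fun h => hb (h ▸ ha)
        have := Finset.min'_le
          (Finset.univ.filter fun j : Fin n => j ∉ S ∧ a < j) b (Finset.mem_filter.2 ⟨Finset.mem_univ _, hb, hab'⟩)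
        rw [hmin] at this
        exact absurd hbx (not_lt.2 this)
      · rintro ⟨h1, h2⟩
        refine le_antisymm (Finset.min'_le _ _ (by simp [hx, h1])) ?_
        refine Finset.le_min' _ _ _ fun b hb => ?_
        obtain ⟨-, hb, hab⟩ := Finset.mem_filter.1 hb
        by_contra hbx
        exact hb (h2 b hab.le (not_le.1 hbx))
    · simp only [false_iff, not_and]
      intro h1
      exact (h (Finset.filter_nonempty_iff.2 ⟨x, Finset.mem_univ _, hx, h1⟩)).elim
  · simp [ha]

lemma nextSpot_false_eq_some_iff (hx : x ∉ S) :
    nextSpot S a false = some x ↔ a = x ∨ a ∈ rightRun S x := by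
  rw [mem_rightRun]
  unfold nextSpot
  by_cases ha : a ∈ S
  · have hax : a ≠ x := fun h => hx (h ▸ ha)
    simp only [ha, not_true_eq_false, if_false, Bool.false_eq_true, hax, false_or, true_and]
    split_ifs with h
    · rw [Option.some.injEq]
      constructor
      · intro hmax
        have h1 := Finset.max'_mem _ h
        rw [hmax, Finset.mem_filter] at h1
        refine ⟨h1.2.2, fun b hxb hba => ?_⟩
        by_contra hb
        have hba' : b < a := lt_of_le_of_ne hba fun h => hb (h ▸ ha)
        have := Finset.le_max'
          (Finset.univ.filter fun j : Fin n => j ∉ S ∧ j < a) b (Finset.mem_filter.2 ⟨Finset.mem_univ _, hb, hba'⟩)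
        rw [hmax] at this
        exact absurd hxb (not_lt.2 this)
      · rintro ⟨h1, h2⟩
        refine le_antisymm ?_ (Finset.le_max' _ _ (by simp [hx, h1]))
        refine Finset.max'_le _ _ _ fun b hb => ?_
        obtain ⟨-, hb, hba⟩ := Finset.mem_filter.1 hb
        by_contra hbx
        exact hb (h2 b (not_le.1 hbx) hba.le)
    · simp only [false_iff, not_and]
      intro h1
      exact (h (Finset.filter_nonempty_iff.2 ⟨x, Finset.mem_univ _, hx, h1⟩)).elim
  · simp [ha]

lemma nextSpot_true_eq_none_iff : nextSpot S a true = none ↔ ∀ b, a ≤ b → b ∈ S := by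
  unfold nextSpot
  by_cases ha : a ∈ S
  · simp only [ha, not_true_eq_false, if_false, if_true]
    split_ifs with h
    · obtain ⟨x, hx⟩ := h
      obtain ⟨-, hx, hax⟩ := Finset.mem_filter.1 hx
      simp only [false_iff, not_forall]
      exact ⟨x, hax.le, hx⟩
    · simp only [true_iff]
      intro b hab
      by_contra hb
      exact h ⟨b, by simp [hb, lt_of_le_of_ne hab fun h => hb (h ▸ ha)]⟩
  · simp only [ha, not_false_eq_true, if_true, reduceCtorEq, false_iff, not_forall]
    exact ⟨a, le_rfl, ha⟩

lemma nextSpot_false_eq_none_iff : nextSpot S a false = none ↔ ∀ b, b ≤ a → b ∈ S := by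
  unfold nextSpot
  by_cases ha : a ∈ S
  · simp only [ha, not_true_eq_false, if_false, Bool.false_eq_true]
    split_ifs with h
    · obtain ⟨x, hx⟩ := h
      obtain ⟨-, hx, hax⟩ := Finset.mem_filter.1 hx
      simp only [false_iff, not_forall]
      exact ⟨x, hax.le, hx⟩
    · simp only [true_iff]
      intro b hab
      by_contra hb
      exact h ⟨b, by simp [hb, lt_of_le_of_ne hab fun h => hb (h ▸ ha)]⟩
  · simp only [ha, not_false_eq_true, if_true, reduceCtorEq, false_iff, not_forall]
    exact ⟨a, le_rfl, ha⟩

end NextSpot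

lemma notMem_leftRun_self {α : Type*} [LinearOrder α] (S : Finset α) (x : α) :
    x ∉ leftRun S x := fun h => lt_irrefl _ (mem_leftRun.1 h).2.1

lemma notMem_rightRun_self {α : Type*} [LinearOrder α] (S : Finset α) (x : α) :
    x ∉ rightRun S x := fun h => lt_irrefl _ (mem_rightRun.1 h).2.1

/-- Preferring `x` works with either coin, of total weight `1`; a spot of the run before `x` needs
heads, one of the run after it needs tails. -/
lemma sum_nextSpot_eq_some {n : ℕ} (p : ℝ) {S : Finset (Fin n)} {x : Fin n} (hx : x ∉ S) :
    ∑ a, ∑ c, (if nextSpot S a c = some x then coinWeight p c else 0) = parkWeight p S x := by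
  simp only [Fintype.sum_bool, nextSpot_true_eq_some_iff hx, nextSpot_false_eq_some_iff hx,
    ← Finset.mem_insert, Finset.sum_add_distrib, Finset.sum_ite_mem, Finset.univ_inter,
    Finset.sum_const, Finset.card_insert_of_notMem (notMem_leftRun_self S x),
    Finset.card_insert_of_notMem (notMem_rightRun_self S x), coinWeight, parkWeight]
  simp
  ring

lemma stateWeight_eq_fillWeight {n : ℕ} (p : ℝ) (k : ℕ) (T : Finset (Fin n)) :
    stateWeight p k T = fillWeight p k T := by
  induction k generalizing T with
  | zero => simp [stateWeight, fillWeight, occupied, eq_comm]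
  | succ k ih =>
    have h1 : stateWeight p (k + 1) T = ∑ S, stateWeight p k S * ∑ a, ∑ c,
        (if (nextSpot S a c).map (fun s => insert s S) = some T then 1 else 0) *
          coinWeight p c := by
      rw [← sum_outcomes_succ p k (fun S a c =>
        if (nextSpot S a c).map (fun s => insert s S) = some T then 1 else 0), stateWeight]
      refine Finset.sum_congr rfl fun α _ => Finset.sum_congr rfl fun coin _ => ?_
      rw [occupied]
      rcases occupied k (fun i => α i.castSucc) (fun i => coin i.castSucc) with _ | S <;> simp
    -- The new spot is never in `S`, so the new state is `T` exactly when `S` is `T` without that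
    -- spot.
    have h2 : ∀ (S : Finset (Fin n)) (a : Fin n) (c : Bool),
        (if (nextSpot S a c).map (fun s => insert s S) = some T then 1 else 0) * coinWeight p c =
        ∑ x ∈ T, if S = T.erase x then (if nextSpot S a c = some x then coinWeight p c else 0)
          else 0 := by
      intro S a c
      rcases h : nextSpot S a c with _ | s
      · simp
      · have hs := notMem_of_nextSpot_eq_some h
        simp only [Option.map_some, Option.some.injEq]
        split_ifs with hT
        · subst hT
          rw [Finset.sum_eq_single s]
          · simp [hs]
          · intro b _ hb
            simp [Ne.symm hb]
          · simp
        · rw [zero_mul, eq_comm]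
          refine Finset.sum_eq_zero fun x hx => ?_
          split_ifs with hS hsx
          · subst hsx
            exact absurd (by rw [hS, Finset.insert_erase hx]) hT
          · rfl
          · rfl
    rw [h1, fillWeight]
    simp only [h2]
    have h3 : ∀ S : Finset (Fin n), ∑ a, ∑ c, ∑ x ∈ T,
        (if S = T.erase x then (if nextSpot S a c = some x then coinWeight p c else 0) else 0) =
        ∑ x ∈ T, if S = T.erase x then parkWeight p (T.erase x) x else 0 := by
      intro S
      calc _ = ∑ a, ∑ x ∈ T, ∑ c, _ := Finset.sum_congr rfl fun a _ => Finset.sum_comm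
        _ = ∑ x ∈ T, ∑ a, ∑ c, _ := Finset.sum_comm
        _ = _ := by
          refine Finset.sum_congr rfl fun x hx => ?_
          split_ifs with hS
          · subst hS
            exact sum_nextSpot_eq_some p (Finset.notMem_erase x T)
          · simp
    simp only [h3, Finset.mul_sum, mul_ite, mul_zero]
    rw [Finset.sum_comm]
    refine Finset.sum_congr rfl fun x _ => ?_
    rw [Finset.sum_ite_eq']
    simp [ih]

/-! ### Runs at the two ends of the street, and reversal -/

section Transfer

variable {n : ℕ}

lemma leftRun_map_val (S : Finset (Fin n)) (x : Fin n) :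
    leftRun (S.map Fin.valEmbedding) x = (leftRun S x).map Fin.valEmbedding := by
  ext a
  simp only [mem_leftRun, Finset.mem_map, Fin.valEmbedding_apply]
  constructor
  · rintro ⟨⟨a, ha, rfl⟩, h, h'⟩
    refine ⟨a, ⟨ha, h, fun b hb hb' => ?_⟩, rfl⟩
    obtain ⟨c, hc, hcb⟩ := h' b hb hb'
    rwa [← Fin.ext hcb]
  · rintro ⟨a, ⟨ha, h, h'⟩, rfl⟩
    refine ⟨⟨a, ha, rfl⟩, h, fun b hb hb' => ?_⟩
    exact ⟨⟨b, hb'.trans x.2⟩, h' ⟨b, hb'.trans x.2⟩ hb hb', rfl⟩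

lemma rightRun_map_val (S : Finset (Fin n)) (x : Fin n) :
    rightRun (S.map Fin.valEmbedding) x = (rightRun S x).map Fin.valEmbedding := by
  ext a
  simp only [mem_rightRun, Finset.mem_map, Fin.valEmbedding_apply]
  constructor
  · rintro ⟨⟨a, ha, rfl⟩, h, h'⟩
    refine ⟨a, ⟨ha, h, fun b hb hb' => ?_⟩, rfl⟩
    obtain ⟨c, hc, hcb⟩ := h' b hb hb'
    rwa [← Fin.ext hcb]
  · rintro ⟨a, ⟨ha, h, h'⟩, rfl⟩
    refine ⟨⟨a, ha, rfl⟩, h, fun b hb hb' => ?_⟩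
    exact ⟨⟨b, hb'.trans_lt a.2⟩, h' ⟨b, hb'.trans_lt a.2⟩ hb hb', rfl⟩

lemma fillWeight_map_val (p : ℝ) (k : ℕ) (T : Finset (Fin n)) :
    fillWeight p k (T.map Fin.valEmbedding) = fillWeight p k T := by
  induction k generalizing T with
  | zero => simp [fillWeight]
  | succ k ih =>
    rw [fillWeight, fillWeight, Finset.sum_map]
    refine Finset.sum_congr rfl fun x _ => ?_
    rw [← Finset.map_erase, ih, parkWeight, parkWeight, Fin.valEmbedding_apply, leftRun_map_val,
      rightRun_map_val, Finset.card_map, Finset.card_map]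

lemma leftRun_map_rev (S : Finset (Fin n)) (x : Fin n) :
    leftRun (S.map Fin.revPerm.toEmbedding) x.rev =
      (rightRun S x).map Fin.revPerm.toEmbedding := by
  ext a
  simp only [mem_leftRun, mem_rightRun, Finset.mem_map_equiv, Fin.revPerm_symm, Fin.revPerm_apply]
  refine and_congr_right fun _ => and_congr (by rw [Fin.lt_rev_iff]) ?_
  refine (Fin.revPerm.forall_congr_right (q := fun b => a ≤ b → b < x.rev → b.rev ∈ S)).symm.trans ?_
  simp only [Fin.revPerm_apply, Fin.rev_rev, Fin.rev_lt_rev]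
  refine forall_congr' fun b => ?_
  rw [Fin.le_rev_iff]
  exact imp.swap

lemma rightRun_map_rev (S : Finset (Fin n)) (x : Fin n) :
    rightRun (S.map Fin.revPerm.toEmbedding) x.rev =
      (leftRun S x).map Fin.revPerm.toEmbedding := by
  ext a
  simp only [mem_leftRun, mem_rightRun, Finset.mem_map_equiv, Fin.revPerm_symm, Fin.revPerm_apply]
  refine and_congr_right fun _ => and_congr (by rw [Fin.rev_lt_iff]) ?_
  refine (Fin.revPerm.forall_congr_right (q := fun b => x.rev < b → b ≤ a → b.rev ∈ S)).symm.trans ?_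
  simp only [Fin.revPerm_apply, Fin.rev_rev, Fin.rev_lt_rev]
  refine forall_congr' fun b => ?_
  rw [Fin.rev_le_iff]
  exact imp.swap

/-- Reversing the street exchanges heads and tails. -/
lemma fillWeight_map_rev (p : ℝ) (k : ℕ) (T : Finset (Fin n)) :
    fillWeight p k (T.map Fin.revPerm.toEmbedding) = fillWeight (1 - p) k T := by
  induction k generalizing T with
  | zero => simp [fillWeight]
  | succ k ih =>
    rw [fillWeight, fillWeight, Finset.sum_map]
    refine Finset.sum_congr rfl fun x _ => ?_
    rw [← Finset.map_erase, ih, parkWeight, parkWeight, Equiv.coe_toEmbedding, Fin.revPerm_apply,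
      leftRun_map_rev, rightRun_map_rev, Finset.card_map, Finset.card_map]
    ring

open scoped Classical in
/-- The run of occupied spots at the start of the street. -/
noncomputable def firstRun (S : Finset (Fin n)) : Finset (Fin n) :=
  Finset.univ.filter fun a => ∀ b, b ≤ a → b ∈ S

open scoped Classical in
/-- The run of occupied spots at the end of the street. -/
noncomputable def lastRun (S : Finset (Fin n)) : Finset (Fin n) :=
  Finset.univ.filter fun a => ∀ b, a ≤ b → b ∈ S

lemma mem_firstRun {S : Finset (Fin n)} {a : Fin n} : a ∈ firstRun S ↔ ∀ b, b ≤ a → b ∈ S := by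
  simp [firstRun]

lemma mem_lastRun {S : Finset (Fin n)} {a : Fin n} : a ∈ lastRun S ↔ ∀ b, a ≤ b → b ∈ S := by
  simp [lastRun]

lemma lastRun_eq_map_rev (S : Finset (Fin n)) :
    lastRun S = (firstRun (S.map Fin.revPerm.toEmbedding)).map Fin.revPerm.toEmbedding := by
  ext a
  simp only [mem_lastRun, mem_firstRun, Finset.mem_map_equiv, Fin.revPerm_symm, Fin.revPerm_apply]
  rw [← Fin.revPerm.forall_congr_right (q := fun b => a ≤ b → b ∈ S)]
  simp only [Fin.revPerm_apply, Fin.le_rev_iff]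

lemma runFrom_map_val (S : Finset (Fin n)) :
    runFrom 0 (S.map Fin.valEmbedding) = (firstRun S).map Fin.valEmbedding := by
  ext a
  simp only [runFrom, Finset.mem_filter, Finset.mem_map, mem_firstRun, Fin.valEmbedding_apply]
  constructor
  · rintro ⟨⟨a, ha, rfl⟩, -, h⟩
    refine ⟨a, fun b hb => ?_, rfl⟩
    obtain ⟨c, hc, hcb⟩ := h b (Nat.zero_le _) hb
    rwa [← Fin.ext hcb]
  · rintro ⟨a, h, rfl⟩
    exact ⟨⟨a, h a le_rfl, rfl⟩, Nat.zero_le _, fun b _ hb =>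
      ⟨⟨b, hb.trans_lt a.2⟩, h ⟨b, hb.trans_lt a.2⟩ hb, rfl⟩⟩

lemma firstRun_map_val (S : Finset (Fin n)) :
    (firstRun S).map Fin.valEmbedding = range #(firstRun S) := by
  obtain ⟨s, -, hs⟩ := exists_eq_Ico_union 0 (S.map Fin.valEmbedding) fun _ _ => Nat.zero_le _
  have h := runFrom_map_val S
  rw [hs, runFrom_Ico_union 0 s fun t ht => (Finset.mem_filter.1 ht).2] at h
  have hcard := congrArg Finset.card h
  rw [Finset.card_map, Nat.card_Ico] at hcard
  rw [← h, ← hcard, Finset.range_eq_Ico]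
  simp

lemma sum_range_natCast_succ (s : ℕ) :
    ∑ i ∈ range s, ((i : ℝ) + 1) = s * (s + 1) / 2 := by
  induction s with
  | zero => simp
  | succ s ih => rw [Finset.sum_range_succ, ih]; push_cast; ring

lemma sum_firstRun (S : Finset (Fin n)) :
    ∑ a ∈ firstRun S, ((a : ℕ) + 1 : ℝ) = #(firstRun S) * (#(firstRun S) + 1) / 2 := by
  rw [← sum_range_natCast_succ, ← firstRun_map_val, Finset.sum_map]
  simp

lemma card_lastRun (S : Finset (Fin n)) :
    #(lastRun S) = #(firstRun (S.map Fin.revPerm.toEmbedding)) := by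
  rw [lastRun_eq_map_rev, Finset.card_map]

lemma sum_lastRun (S : Finset (Fin n)) :
    ∑ a ∈ lastRun S, ((a : ℕ) + 1 : ℝ) =
      (n + 1) * #(lastRun S) - #(lastRun S) * (#(lastRun S) + 1) / 2 := by
  rw [card_lastRun, ← sum_firstRun, lastRun_eq_map_rev, Finset.sum_map, eq_sub_iff_add_eq,
    ← Finset.sum_add_distrib]
  have h : ∀ a ∈ firstRun (S.map Fin.revPerm.toEmbedding),
      (((Fin.revPerm.toEmbedding a : Fin n) : ℕ) + 1 : ℝ) + ((a : ℕ) + 1) = n + 1 := by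
    intro a _
    rw [Equiv.coe_toEmbedding, Fin.revPerm_apply, Fin.val_rev, Nat.cast_sub (by omega)]
    push_cast
    ring
  rw [Finset.sum_congr rfl h, Finset.sum_const, nsmul_eq_mul, mul_comm]

/-- The law of the length of the initial run after `k` cars. -/
lemma sum_fillWeight_mul_firstRun (p : ℝ) {k : ℕ} (hk : k < n) (f : ℕ → ℝ) :
    ∑ S : Finset (Fin n), fillWeight p k S * f #(firstRun S) =
      k ! * ∑ q ∈ antidiagonal k, f q.1 * (abelA 1 q.1 * abelA (n - k) q.2) := by
  have h1 : Ico 0 (0 + n) = (Finset.univ : Finset (Fin n)).map Fin.valEmbedding := by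
    rw [Fin.map_valEmbedding_univ]
    ext x
    simp
  rw [← sum_blockWeight_mul p hk 0 f, h1, Finset.powersetCard_map, Finset.sum_map, Finset.mul_sum]
  rw [← Finset.sum_subset (Finset.subset_univ (powersetCard k Finset.univ))]
  · refine Finset.sum_congr rfl fun S hS => ?_
    have hS := (Finset.mem_powersetCard.1 hS).2
    have h2 := fillWeight_card p (S.map Fin.valEmbedding)
    rw [Finset.card_map, hS, fillWeight_map_val] at h2
    simp only [RelEmbedding.coe_toEmbedding, Finset.mapEmbedding_apply]
    rw [h2, runFrom_map_val, Finset.card_map]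
    ring
  · intro S _ hS
    rw [fillWeight_of_card_ne, zero_mul]
    simpa [Finset.mem_powersetCard] using hS

/-- Reversal carries this to the first run with `1 - p` in place of `p`, and the law of the first
run does not involve `p`. -/
lemma sum_fillWeight_mul_lastRun (p : ℝ) {k : ℕ} (hk : k < n) (f : ℕ → ℝ) :
    ∑ S : Finset (Fin n), fillWeight p k S * f #(lastRun S) =
      k ! * ∑ q ∈ antidiagonal k, f q.1 * (abelA 1 q.1 * abelA (n - k) q.2) := by
  rw [← sum_fillWeight_mul_firstRun (1 - p) hk f]
  refine Fintype.sum_equiv Fin.revPerm.finsetCongr _ _ fun S => ?_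
  rw [Equiv.finsetCongr_apply, fillWeight_map_rev, card_lastRun, sub_sub_cancel]

end Transfer

/-! ### The conditional expectation through run moments -/

lemma sum_isSome_nextSpot {n : ℕ} (p : ℝ) (S : Finset (Fin n)) (h : Fin n → ℝ) :
    ∑ a, ∑ c, (if (nextSpot S a c).isSome then h a else 0) * coinWeight p c =
      ∑ a, h a - p * ∑ a ∈ lastRun S, h a - (1 - p) * ∑ a ∈ firstRun S, h a := by
  have h1 : ∀ a c, (nextSpot S a c).isSome = true ↔ ¬ nextSpot S a c = none := fun a c => by
    rw [← ne_eq, ← Option.isSome_iff_ne_none]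
  have h2 : ∀ T : Finset (Fin n), ∑ a ∈ T, h a = ∑ a, if a ∈ T then h a else 0 := fun T => by
    rw [Finset.sum_ite_mem, Finset.univ_inter]
  rw [h2 (lastRun S), h2 (firstRun S), Finset.mul_sum, Finset.mul_sum, ← Finset.sum_sub_distrib,
    ← Finset.sum_sub_distrib]
  refine Finset.sum_congr rfl fun a _ => ?_
  simp only [Fintype.sum_bool, h1, nextSpot_true_eq_none_iff, nextSpot_false_eq_none_iff,
    ← mem_lastRun, ← mem_firstRun, coinWeight]
  by_cases ha : a ∈ lastRun S <;> by_cases hb : a ∈ firstRun S <;> simp [ha, hb] <;> ring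

lemma sum_allPark {n : ℕ} (p : ℝ) (k : ℕ) (h : Fin n → ℝ) :
    ∑ α : Fin (k + 1) → Fin n, ∑ coin : Fin (k + 1) → Bool,
      (if AllPark α coin then h (α (Fin.last k)) * outcomeProb p α coin else 0) =
    ((n : ℝ) ^ (k + 1))⁻¹ * ∑ S, fillWeight p k S *
      (∑ a, h a - p * ∑ a ∈ lastRun S, h a - (1 - p) * ∑ a ∈ firstRun S, h a) := by
  simp only [← sum_isSome_nextSpot, ← stateWeight_eq_fillWeight]
  rw [← sum_outcomes_succ p k (fun S a c => if (nextSpot S a c).isSome then h a else 0),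
    Finset.mul_sum]
  refine Finset.sum_congr rfl fun α _ => ?_
  rw [Finset.mul_sum]
  refine Finset.sum_congr rfl fun coin _ => ?_
  have h1 : outcomeProb p α coin = ((n : ℝ) ^ (k + 1))⁻¹ * ∏ i, coinWeight p (coin i) := rfl
  rw [h1]
  have h2 : AllPark α coin ↔ ((occupied k (fun i => α i.castSucc) (fun i => coin i.castSucc)).bind
    fun occ => (nextSpot occ (α (Fin.last k)) (coin (Fin.last k))).map
      fun s => insert s occ).isSome = true := Iff.rfl
  rcases ho : occupied k (fun i => α i.castSucc) (fun i => coin i.castSucc) with _ | S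
  · rw [if_neg (by rw [h2, ho]; simp)]
    simp
  · rw [ho, Option.bind_some, Option.isSome_map] at h2
    rw [Option.elim_some]
    by_cases hs : (nextSpot S (α (Fin.last k)) (coin (Fin.last k))).isSome = true
    · rw [if_pos (h2.2 hs), if_pos hs]
      ring
    · rw [if_neg (mt h2.1 hs), if_neg hs]
      ring

/-- The `j`-th moment of the length of a run at an end of the street of `n` spots, when `k` cars
have parked. -/
noncomputable def runMoment (n k j : ℕ) : ℝ :=
  ∑ q ∈ antidiagonal k, (q.1 : ℝ) ^ j * (abelA 1 q.1 * abelA (n - k) q.2)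

/-- The absence of mixed terms means that only the marginal laws of the two runs enter, and these
coincide. -/
lemma sum_fillWeight_mul_quadratic {n : ℕ} (p : ℝ) {k : ℕ} (hk : k < n) (u v₁ v₂ w₁ w₂ : ℝ) :
    ∑ S : Finset (Fin n), fillWeight p k S * (u + (v₁ * #(lastRun S) + v₂ * (#(lastRun S) : ℝ) ^ 2) +
      (w₁ * #(firstRun S) + w₂ * (#(firstRun S) : ℝ) ^ 2)) =
    k ! * (u * runMoment n k 0 + (v₁ + w₁) * runMoment n k 1 + (v₂ + w₂) * runMoment n k 2) := by
  have h1 := sum_fillWeight_mul_lastRun p hk fun s => u + v₁ * s + v₂ * (s : ℝ) ^ 2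
  have h2 := sum_fillWeight_mul_firstRun p hk fun s => w₁ * s + w₂ * (s : ℝ) ^ 2
  have h3 : ∀ S : Finset (Fin n), fillWeight p k S * (u + (v₁ * #(lastRun S) +
      v₂ * (#(lastRun S) : ℝ) ^ 2) + (w₁ * #(firstRun S) + w₂ * (#(firstRun S) : ℝ) ^ 2)) =
      fillWeight p k S * (u + v₁ * #(lastRun S) + v₂ * (#(lastRun S) : ℝ) ^ 2) +
      fillWeight p k S * (w₁ * #(firstRun S) + w₂ * (#(firstRun S) : ℝ) ^ 2) := fun S => by ring
  rw [Finset.sum_congr rfl fun S _ => h3 S, Finset.sum_add_distrib, h1, h2, ← mul_add,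
    ← Finset.sum_add_distrib]
  simp only [runMoment, Finset.mul_sum, ← Finset.sum_add_distrib]
  exact Finset.sum_congr rfl fun q _ => by ring

lemma probAllPark_succ {n : ℕ} (p : ℝ) {k : ℕ} (hk : k < n) :
    probAllPark (k + 1) n p =
      ((n : ℝ) ^ (k + 1))⁻¹ * (k ! * (n * runMoment n k 0 - runMoment n k 1)) := by
  have h := sum_allPark (n := n) p k fun _ => 1
  simp only [one_mul] at h
  rw [probAllPark, h]
  congr 1
  have h2 := sum_fillWeight_mul_quadratic p hk n (-p) 0 (-(1 - p)) 0
  rw [show (k ! : ℝ) * (n * runMoment n k 0 - runMoment n k 1) = k ! * (n * runMoment n k 0 +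
    (-p + -(1 - p)) * runMoment n k 1 + (0 + 0) * runMoment n k 2) by ring, ← h2]
  refine Finset.sum_congr rfl fun S _ => ?_
  simp only [Finset.sum_const, nsmul_eq_mul, mul_one, Finset.card_univ, Fintype.card_fin]
  ring

lemma condExpLastPref_succ {n : ℕ} (p : ℝ) {k : ℕ} (hk : k < n)
    (hne : n * runMoment n k 0 - runMoment n k 1 ≠ 0) :
    condExpLastPref (k + 1) n p = (n + 1) / 2 - (2 * p - 1) / 2 *
      ((n * runMoment n k 1 - runMoment n k 2) / (n * runMoment n k 0 - runMoment n k 1)) := by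
  have h := sum_allPark (n := n) p k fun a => ((a : ℕ) + 1 : ℝ)
  have hn : ∑ a : Fin n, ((a : ℕ) + 1 : ℝ) = n * (n + 1) / 2 := by
    rw [Fin.sum_univ_eq_sum_range (fun i => (i + 1 : ℝ)) n, sum_range_natCast_succ]
  -- The coefficients come from expanding `-p ((n + 1) L - L (L + 1)/2)` for the last run and `-(1 -
  -- p) F (F + 1)/2` for the first.
  have h2 := sum_fillWeight_mul_quadratic p hk (n * (n + 1) / 2) (-p * (n + 1 / 2)) (p / 2)
    (-(1 - p) / 2) (-(1 - p) / 2)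
  have h3 : ∑ α : Fin (k + 1) → Fin n, ∑ coin : Fin (k + 1) → Bool,
      (if AllPark α coin then (lastPref α : ℝ) * outcomeProb p α coin else 0) =
      ((n : ℝ) ^ (k + 1))⁻¹ * (k ! * ((n + 1) / 2 * (n * runMoment n k 0 - runMoment n k 1) -
        (2 * p - 1) / 2 * (n * runMoment n k 1 - runMoment n k 2))) := by
    simp only [lastPref, Nat.cast_add, Nat.cast_one]
    rw [h]
    congr 1
    trans
    · refine Eq.trans (Finset.sum_congr rfl fun S _ => ?_) h2
      rw [hn, sum_lastRun, sum_firstRun]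
      ring
    · ring
  have h4 : ((n : ℝ) ^ (k + 1))⁻¹ ≠ 0 := by
    have : (n : ℝ) ≠ 0 := by norm_cast; omega
    positivity
  have h5 : (k ! : ℝ) ≠ 0 := by positivity
  rw [condExpLastPref, h3, probAllPark_succ p hk, mul_div_mul_left _ _ h4, mul_div_mul_left _ _ h5,
    sub_div, mul_div_assoc, div_self hne, mul_one, mul_div_assoc]

/-! ### Exact formula -/

/-- The base `1 + (n - k) + k = n + 1` is free of `k` and `l`; the factor `(n + 1)^k / k!`, common
to all moments, cancels in the final quotient. -/
lemma abelC_eq_descFactorial {n k : ℕ} (l : ℕ) :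
    abelC l (1 + (n - k)) k =
      ((n : ℝ) + 1) ^ k / k ! * (k.descFactorial l / ((n : ℝ) + 1) ^ l) := by
  rcases le_or_gt l k with h | h
  · have h1 : (1 + ((n : ℝ) - k) + k) = n + 1 := by ring
    have h2 : ((k - l)! : ℝ) * k.descFactorial l = k ! := by
      exact_mod_cast Nat.factorial_mul_descFactorial h
    have h3 : ((k - l)! : ℝ) ≠ 0 := by positivity
    have h4 : (k.descFactorial l : ℝ) ≠ 0 := by
      exact_mod_cast (Nat.descFactorial_pos.2 h).ne'
    have h5 : ((n : ℝ) + 1) ^ k = (n + 1) ^ (k - l) * (n + 1) ^ l := by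
      rw [← pow_add, Nat.sub_add_cancel h]
    have h6 : (n : ℝ) + 1 ≠ 0 := by positivity
    rw [abelC_of_le h, h1, h5, ← h2]
    field_simp
  · rw [abelC_of_lt h, Nat.descFactorial_of_lt h]
    simp

/-- The truncated sum that governs the second moment of the run length. -/
noncomputable def descSum (n k : ℕ) : ℝ :=
  ∑ l ∈ range (k + 1), ((l : ℝ) + 1) * (k.descFactorial l / ((n : ℝ) + 1) ^ l)

lemma runMoment_zero (n k : ℕ) :
    runMoment n k 0 = ((n : ℝ) + 1) ^ k / k ! * (1 - k / (n + 1)) := by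
  simp only [runMoment, pow_zero, one_mul]
  rw [sum_abelA_one_mul_abelA, abelA_eq_sub, abelC_eq_descFactorial, abelC_eq_descFactorial]
  simp
  ring

lemma runMoment_one (n k : ℕ) :
    runMoment n k 1 = ((n : ℝ) + 1) ^ k / k ! * (k / (n + 1)) := by
  simp only [runMoment, pow_one]
  rw [sum_natCast_mul_abelA_one_mul_abelA, abelC_eq_descFactorial]
  simp

lemma runMoment_two (n k : ℕ) :
    runMoment n k 2 = ((n : ℝ) + 1) ^ k / k ! * (descSum n k - 1 - k / (n + 1)) := by
  rw [runMoment, sum_natCast_sq_mul_abelA_one_mul_abelA]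
  simp only [abelC_eq_descFactorial, descSum]
  rw [mul_sub, mul_sub, Finset.mul_sum]
  simp
  exact Finset.sum_congr rfl fun l _ => by ring

lemma natCast_mul_runMoment_zero_sub (n k : ℕ) :
    n * runMoment n k 0 - runMoment n k 1 = ((n : ℝ) + 1) ^ k / k ! * (n - k) := by
  have h : (n : ℝ) + 1 ≠ 0 := by positivity
  rw [runMoment_zero, runMoment_one]
  field_simp
  ring

lemma natCast_mul_runMoment_one_sub (n k : ℕ) :
    n * runMoment n k 1 - runMoment n k 2 =
      ((n : ℝ) + 1) ^ k / k ! * (k + 1 - descSum n k) := by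
  have h : (n : ℝ) + 1 ≠ 0 := by positivity
  rw [runMoment_two, runMoment_one]
  field_simp
  ring

lemma probAllPark_succ_pos {n : ℕ} (p : ℝ) {k : ℕ} (hk : k < n) :
    0 < probAllPark (k + 1) n p := by
  rw [probAllPark_succ p hk, natCast_mul_runMoment_zero_sub]
  have h1 : (0 : ℝ) < n - k := sub_pos.2 (by exact_mod_cast hk)
  have h2 : (0 : ℝ) < n := by exact_mod_cast (Nat.zero_le k).trans_lt hk
  positivity

/-- An exact formula for the conditional expectation of the last preference. -/
lemma condExpLastPref_succ_eq {n : ℕ} (p : ℝ) {k : ℕ} (hk : k < n) :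
    condExpLastPref (k + 1) n p =
      (n + 1) / 2 - (2 * p - 1) / 2 * ((k + 1 - descSum n k) / (n - k)) := by
  have h1 : (0 : ℝ) < n - k := sub_pos.2 (by exact_mod_cast hk)
  have h2 : ((n : ℝ) + 1) ^ k / k ! ≠ 0 := by positivity
  rw [condExpLastPref_succ p hk, natCast_mul_runMoment_zero_sub, natCast_mul_runMoment_one_sub,
    mul_div_mul_left _ _ h2]
  rw [natCast_mul_runMoment_zero_sub]
  exact mul_ne_zero h2 h1.ne'

/-! ### Asymptotics -/

lemma descFactorial_div_pow_bounds {c : ℝ} (hc0 : 0 < c) (hc1 : c < 1) {n k : ℕ}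
    (hk : (k : ℝ) + 1 = c * n) (l : ℕ) :
    0 ≤ k.descFactorial l / ((n : ℝ) + 1) ^ l ∧ k.descFactorial l / ((n : ℝ) + 1) ^ l ≤ c ^ l ∧
      c ^ l - k.descFactorial l / ((n : ℝ) + 1) ^ l ≤ l * (l + 1) * c ^ l / (c * (n + 1)) := by
  have hN : (0 : ℝ) < n + 1 := by positivity
  refine ⟨by positivity, ?_⟩
  induction l with
  | zero => simp
  | succ l ih =>
    set d : ℝ := k.descFactorial l / ((n : ℝ) + 1) ^ l with hd
    have hd0 : 0 ≤ d := by positivity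
    have hstep : k.descFactorial (l + 1) / ((n : ℝ) + 1) ^ (l + 1) = d * ((k - l) / (n + 1)) := by
      rw [Nat.descFactorial_succ, hd, pow_succ]
      rcases le_or_gt l k with h | h
      · push_cast [Nat.cast_sub h]
        field_simp
      · simp [Nat.descFactorial_of_lt h]
    -- Each step costs at most `c ^ l (l + 2)/(n + 1)`, and `l + 2 ≤ (l + 1)(l + 2) - l(l + 1)`
    -- explains the factor `l (l + 1)` in the bound.
    have hratio : ((k : ℝ) - l) / (n + 1) = c - (c + 1 + l) / (n + 1) := by
      field_simp
      linarith
    have hle : (c + 1 + l) / ((n : ℝ) + 1) ≤ (l + 2) / (n + 1) :=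
      div_le_div_of_nonneg_right (by linarith) hN.le
    have hge : 0 ≤ (c + 1 + l) / ((n : ℝ) + 1) := by positivity
    obtain ⟨ih1, ih2⟩ := ih
    rw [hstep, hratio]
    constructor
    · calc d * (c - (c + 1 + l) / (n + 1)) ≤ d * c := by gcongr; linarith
        _ ≤ c ^ l * c := by gcongr
        _ = c ^ (l + 1) := (pow_succ _ _).symm
    · calc c ^ (l + 1) - d * (c - (c + 1 + l) / (n + 1))
          = c * (c ^ l - d) + d * ((c + 1 + l) / (n + 1)) := by ring
        _ ≤ c * (l * (l + 1) * c ^ l / (c * (n + 1))) + c ^ l * ((l + 2) / (n + 1)) := by gcongr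
        _ = (l ^ 2 + 2 * l + 2) * c ^ l / (n + 1) := by field_simp; ring
        _ ≤ ((l + 1) * (l + 1 + 1)) * c ^ l / (n + 1) := by
          gcongr
          nlinarith [(Nat.cast_nonneg l : (0 : ℝ) ≤ l)]
        _ = _ := by
          push_cast
          rw [pow_succ]
          field_simp

/-- Falling factorials vanish beyond `k`, so the truncated sum is a full series; it is compared
termwise with `∑ (l + 1) c ^ l`, the errors being summable uniformly in `n`. -/
lemma exists_abs_descSum_sub_le {c : ℝ} (hc0 : 0 < c) (hc1 : c < 1) :
    ∃ K : ℝ, 0 ≤ K ∧ ∀ n k : ℕ, (k : ℝ) + 1 = c * n →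
      |descSum n k - 1 / (1 - c) ^ 2| ≤ K / (n + 1) := by
  have hnorm : ‖c‖ < 1 := by rwa [Real.norm_of_nonneg hc0.le]
  have hsum : Summable fun l : ℕ => ((l : ℝ) + 1) * (l * (l + 1) * c ^ l / c) := by
    have h := ((summable_pow_mul_geometric_of_norm_lt_one 3 hnorm).add
      (((summable_pow_mul_geometric_of_norm_lt_one 2 hnorm).mul_left 2).add
        (summable_pow_mul_geometric_of_norm_lt_one 1 hnorm))).div_const c
    refine h.congr fun l => ?_
    ring
  refine ⟨∑' l : ℕ, ((l : ℝ) + 1) * (l * (l + 1) * c ^ l / c),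
    tsum_nonneg fun l => by positivity, fun n k hk => ?_⟩
  have h1 : HasSum (fun l : ℕ => ((l : ℝ) + 1) * (k.descFactorial l / ((n : ℝ) + 1) ^ l))
      (descSum n k) := by
    refine hasSum_sum_of_ne_finset_zero fun l hl => ?_
    rw [Nat.descFactorial_of_lt (by simpa using hl)]
    simp
  have h2 : HasSum (fun l : ℕ => ((l : ℝ) + 1) * c ^ l) (1 / (1 - c) ^ 2) := by
    simpa using hasSum_choose_mul_geometric_of_norm_lt_one 1 hnorm
  refine (h1.sub h2).norm_le_of_bounded (hsum.hasSum.div_const ((n : ℝ) + 1)) fun l => ?_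
  obtain ⟨-, hb1, hb2⟩ := descFactorial_div_pow_bounds hc0 hc1 hk l
  rw [← mul_sub, norm_mul, Real.norm_of_nonneg (by positivity), norm_sub_rev,
    Real.norm_of_nonneg (sub_nonneg.2 hb1), mul_div_assoc, div_div]
  gcongr

end ProbParking

theorem proposition2p9 (c : ℝ) (hc0 : 0 < c) (hc1 : c < 1) :
    ∃ C : ℝ, ∃ N : ℕ, ∀ p : ℝ, 0 ≤ p → p ≤ 1 → ∀ m n : ℕ, N ≤ n → (m : ℝ) = c * n →
      0 < ProbParking.probAllPark m n p ∧
      |ProbParking.condExpLastPref m n p -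
          (((n : ℝ) + 1) / 2 - (2 * p - 1) * (c / (2 * (1 - c))) -
            1 / (n : ℝ) * (2 * p - 1) * ((c ^ 2 - c - 1) / (2 * (1 - c) ^ 3)))| ≤
        C / (n : ℝ) ^ 2 := by
  obtain ⟨K, hK0, hK⟩ := ProbParking.exists_abs_descSum_sub_le hc0 hc1
  have hd : 0 < 1 - c := sub_pos.2 hc1
  -- The first term bounds the remainder of expanding `1/((1 - c) n + 1)`, the second the error in
  -- `descSum`; both use `(1 - c) n + 1 ≥ (1 - c) n`.
  refine ⟨(1 / (1 - c) + c) / (1 - c) ^ 3 + K / (1 - c), 1, fun p hp0 hp1 m n hn hm => ?_⟩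
  have hn0 : (0 : ℝ) < n := by exact_mod_cast hn
  have hm0 : 0 < m := by
    have : (0 : ℝ) < m := hm ▸ mul_pos hc0 hn0
    exact_mod_cast this
  obtain ⟨k, rfl⟩ : ∃ k, m = k + 1 := ⟨m - 1, by omega⟩
  have hk : (k : ℝ) + 1 = c * n := by rw [← hm]; push_cast; ring
  have hkn : k < n := by
    have : (k : ℝ) < n := by nlinarith
    exact_mod_cast this
  refine ⟨ProbParking.probAllPark_succ_pos p hkn, ?_⟩
  rw [ProbParking.condExpLastPref_succ_eq p hkn]
  set ε := ProbParking.descSum n k - 1 / (1 - c) ^ 2 with hε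
  have hD : (0 : ℝ) < (1 - c) * n + 1 := by positivity
  have hT : ProbParking.descSum n k = ε + 1 / (1 - c) ^ 2 := by rw [hε]; ring
  have hnk : (n : ℝ) - k = (1 - c) * n + 1 := by linarith
  have hεn : |ε| ≤ K / n := (hK n k hk).trans (by gcongr; linarith)
  have hexact : ((n : ℝ) + 1) / 2 - (2 * p - 1) / 2 * ((k + 1 - ProbParking.descSum n k) / (n - k)) -
      (((n : ℝ) + 1) / 2 - (2 * p - 1) * (c / (2 * (1 - c))) -
        1 / (n : ℝ) * (2 * p - 1) * ((c ^ 2 - c - 1) / (2 * (1 - c) ^ 3))) =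
      -((2 * p - 1) / 2) * ((1 / (1 - c) + c) / ((1 - c) ^ 2 * n * ((1 - c) * n + 1)) -
        ε / ((1 - c) * n + 1)) := by
    rw [hk, hT, hnk]
    field_simp
    ring
  have hp : |-((2 * p - 1) / 2)| ≤ 1 := by
    rw [abs_le]
    constructor <;> linarith
  have hDn : (1 - c) * n ≤ (1 - c) * n + 1 := by linarith
  rw [hexact, abs_mul]
  calc |-((2 * p - 1) / 2)| * |(1 / (1 - c) + c) / ((1 - c) ^ 2 * n * ((1 - c) * n + 1)) -
        ε / ((1 - c) * n + 1)|
      ≤ 1 * (|(1 / (1 - c) + c) / ((1 - c) ^ 2 * n * ((1 - c) * n + 1))| +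
        |ε / ((1 - c) * n + 1)|) := by
        gcongr
        exact abs_sub _ _
    _ = (1 / (1 - c) + c) / ((1 - c) ^ 2 * n * ((1 - c) * n + 1)) +
        |ε| / ((1 - c) * n + 1) := by
        rw [one_mul, abs_div ε, abs_of_pos hD, abs_of_nonneg (by positivity)]
    _ ≤ (1 / (1 - c) + c) / ((1 - c) ^ 2 * n * ((1 - c) * n)) + K / n / ((1 - c) * n) := by
        gcongr
    _ = ((1 / (1 - c) + c) / (1 - c) ^ 3 + K / (1 - c)) / (n : ℝ) ^ 2 := by
        field_simp
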